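/- Let $K$ be a field and $q\in K$ with $q\neq 1$ (for instance $K=\mathbb{Q}(q)$ with $q$ an indeterminate, or $q$ a real or complex number). Put $[m]_q=\frac{1-q^m}{1-q}$, and define the $q$-secant numbers $E_{2n}(q)\in K$, $n\ge 0$, by the identity of formal power series in $x$ $$\sum_{n=0}^{\infty} E_{2n}(q)\,x^n=\cfrac{1}{1-\cfrac{[1]_q^2\,x}{1-\cfrac{[2]_q^2\,x}{1-\cfrac{[3]_q^2\,x}{\ddots}}}},$$ where the infinite continued fraction is the formal limit (coefficient by coefficient) of its finite truncations. Then for every integer $n\ge 0$ $$E_{2n}(q)=\frac{1}{(1-q)^{2n}}\sum_{k=0}^{n}\left(\binom{2n}{n-k}-\binom{2n}{n-k-1}\right)\sum_{i=0}^{2k}(-1)^{i+k}\,q^{\,i(2k-i)+k},$$ where $\binom{2n}{-1}=0$ and $q^0=1$ (also when $q=0$). -/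

import Mathlib

/-- The `m`-th truncation, as a formal power series in `X` over the field `K`, of the continued
fraction `1 / (1 - c 0 * X / (1 - c 1 * X / (1 - c 2 * X / ...)))`: it involves `c 0, ..., c (m-1)`.
Every denominator has constant term `1`, so that the inverses are genuine inverses. -/
noncomputable def cfTrunc {K : Type*} [Field K] (c : ℕ → K) : ℕ → PowerSeries K
  | 0 => 1
  | m + 1 => (1 - PowerSeries.C (c 0) * PowerSeries.X * cfTrunc (fun j => c (j + 1)) m)⁻¹

theorem X_pow_dvd_cfTrunc_sub {K : Type*} [Field K] (n : ℕ) :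
    ∀ (c : ℕ → K) (m : ℕ), n ≤ m →
      (PowerSeries.X : PowerSeries K) ^ (n + 1) ∣ cfTrunc c m - cfTrunc c n := by
  induction n with
  | zero =>
    intro c m _
    rw [zero_add, pow_one, PowerSeries.X_dvd_iff]
    cases m <;> simp [cfTrunc]
  | succ n ih =>
    intro c m hm
    obtain ⟨m, rfl⟩ : ∃ m', m = m' + 1 := ⟨m - 1, by omega⟩
    obtain ⟨r, hr⟩ := ih (fun j => c (j + 1)) m (by omega)
    simp only [cfTrunc]
    set a := cfTrunc (fun j => c (j + 1)) m
    set b := cfTrunc (fun j => c (j + 1)) n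
    have hA := PowerSeries.mul_inv_cancel
      (1 - PowerSeries.C (c 0) * PowerSeries.X * a) (by simp)
    have hB := PowerSeries.mul_inv_cancel
      (1 - PowerSeries.C (c 0) * PowerSeries.X * b) (by simp)
    set A := (1 - PowerSeries.C (c 0) * PowerSeries.X * a)⁻¹
    set B := (1 - PowerSeries.C (c 0) * PowerSeries.X * b)⁻¹
    refine ⟨PowerSeries.C (c 0) * r * A * B, ?_⟩
    linear_combination B * hA - A * hB + (PowerSeries.C (c 0) * PowerSeries.X * A * B) * hr

/-- The formal power series defined by the infinite continued fraction
`1 / (1 - c 0 * X / (1 - c 1 * X / (1 - c 2 * X / ...)))`, that is, the limit of its truncations: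
each coefficient is the eventual value of that coefficient in the truncations
(see `coeff_cfTrunc_eq`). -/
noncomputable def cfSeries {K : Type*} [Field K] (c : ℕ → K) : PowerSeries K :=
  PowerSeries.mk fun n => PowerSeries.coeff n (cfTrunc c n)

theorem coeff_cfTrunc_eq {K : Type*} [Field K] (c : ℕ → K) (n m : ℕ) (h : n ≤ m) :
    PowerSeries.coeff n (cfTrunc c m) = PowerSeries.coeff n (cfSeries c) := by
  have := PowerSeries.X_pow_dvd_iff.1 (X_pow_dvd_cfTrunc_sub n c m h) n (Nat.lt_succ_self n)
  rw [map_sub, sub_eq_zero] at this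
  rw [this, cfSeries, PowerSeries.coeff_mk]

/-- The `q`-integer `[n]_q = (1 - q ^ n) / (1 - q)`, used for `q ≠ 1`. -/
noncomputable def qInt {K : Type*} [Field K] (q : K) (n : ℕ) : K := (1 - q ^ n) / (1 - q)

/-- `qSecant q n` is the `q`-secant number `E_{2n}(q)`: the coefficient of `X ^ n` in
`1 / (1 - [1]_q ^ 2 * X / (1 - [2]_q ^ 2 * X / (1 - [3]_q ^ 2 * X / ...)))`. -/
noncomputable def qSecant {K : Type*} [Field K] (q : K) (n : ℕ) : K :=
  PowerSeries.coeff n (cfSeries fun j => qInt q (j + 1) ^ 2)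

/-- The binomial coefficient with an integer lower index, equal to `0` if this index is negative. -/
def binom (n : ℕ) (k : ℤ) : ℕ := if 0 ≤ k then n.choose k.toNat else 0

/-! The coefficients of a Stieltjes continued fraction are the even moments of any functional for
which the monic polynomials with the same recurrence coefficients are orthogonal. For the
coefficients `(1 - q ^ n) ^ 2` these are symmetric Al-Salam–Chihara polynomials in `t + t⁻¹`, and
the functional is `f ↦ Λ ((t - t⁻¹) * f (t + t⁻¹))`, where `Λ` kills the even powers of `t` and maps
`t ^ (2 * k + 1)` to a partial sum of the theta sum of order `k` (for negative `k`, to minus a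
partial sum of order `-k - 1`). Orthogonality holds because the Askey–Wilson raising operator writes
`(t - t⁻¹) * P (t + t⁻¹)` as a difference of two Laurent polynomials on which `Λ` agrees. In the
even moments, the ballot numbers come from expanding `(t - t⁻¹) * (t + t⁻¹) ^ (2 * n)` in the
differences `t ^ (2 * k + 1) - t ^ (-(2 * k + 1))`, and `Λ` maps each of these to the complete theta
sum of order `k`. -/

section StieltjesArray

variable {R : Type*} [CommRing R]

/-- The array `M n h` of weighted counts of the lattice paths of length `h + 2 * n` from height `h`
to height `0`, a step down from height `j + 1` having weight `c j`, is characterized by removing the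
first step of the paths. Its column `h = 0` holds the coefficients of the Stieltjes continued
fraction `cfSeries c`. -/
structure IsStieltjesArray (c : ℕ → R) (M : ℕ → ℕ → R) : Prop where
  zero_zero : M 0 0 = 1
  zero_succ (h : ℕ) : M 0 (h + 1) = c h * M 0 h
  succ_zero (n : ℕ) : M (n + 1) 0 = M n 1
  succ_succ (n h : ℕ) : M (n + 1) (h + 1) = c h * M (n + 1) h + M n (h + 2)

theorem IsStieltjesArray.unique {c : ℕ → R} {M N : ℕ → ℕ → R} (hM : IsStieltjesArray c M)
    (hN : IsStieltjesArray c N) (n h : ℕ) : M n h = N n h := by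
  induction n generalizing h with
  | zero => induction h with
    | zero => rw [hM.zero_zero, hN.zero_zero]
    | succ h ih => rw [hM.zero_succ, hN.zero_succ, ih]
  | succ n ihn => induction h with
    | zero => rw [hM.succ_zero, hN.succ_zero, ihn]
    | succ h ih => rw [hM.succ_succ, hN.succ_succ, ih, ihn]

theorem IsStieltjesArray.smul {c : ℕ → R} {M : ℕ → ℕ → R} (hM : IsStieltjesArray c M) (a : R) :
    IsStieltjesArray (fun j => a * c j) (fun n h => a ^ (n + h) * M n h) where
  zero_zero := by simp [hM.zero_zero]
  zero_succ h := by rw [hM.zero_succ]; ring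
  succ_zero n := by rw [hM.succ_zero]
  succ_succ n h := by rw [hM.succ_succ]; ring

open PowerSeries in
theorem isStieltjesArray_coeff {c : ℕ → R} {F : ℕ → R⟦X⟧} (h_zero : F 0 = 1 + X * F 1)
    (h_succ : ∀ h, F (h + 1) = C (c h) * F h + X * F (h + 2)) :
    IsStieltjesArray c fun n h => coeff n (F h) where
  zero_zero := by rw [h_zero]; simp
  zero_succ h := by rw [h_succ]; simp
  succ_zero n := by rw [h_zero]; simp [coeff_succ_X_mul, coeff_one]
  succ_succ n h := by rw [h_succ]; simp [coeff_succ_X_mul]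

end StieltjesArray

section ContinuedFraction

open PowerSeries

variable {K : Type*} [Field K]

theorem X_pow_dvd_cfSeries_sub_cfTrunc (c : ℕ → K) (n : ℕ) :
    (X : K⟦X⟧) ^ (n + 1) ∣ cfSeries c - cfTrunc c n := by
  refine X_pow_dvd_iff.2 fun m hm => ?_
  rw [map_sub, coeff_cfTrunc_eq c m n (Nat.lt_succ_iff.1 hm), sub_self]

theorem cfSeries_eq_one_add (c : ℕ → K) :
    cfSeries c = 1 + C (c 0) * X * cfSeries c * cfSeries fun j => c (j + 1) := by
  rw [← sub_eq_zero]
  ext n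
  suffices X ^ (n + 1) ∣ cfSeries c -
      (1 + C (c 0) * X * cfSeries c * cfSeries fun j => c (j + 1)) by
    simpa using X_pow_dvd_iff.1 this n n.lt_succ_self
  set A := cfTrunc c (n + 1)
  set B := cfTrunc (fun j => c (j + 1)) n
  have hAB : A * (1 - C (c 0) * X * B) = 1 := PowerSeries.inv_mul_cancel _ (by simp)
  have hA : X ^ (n + 1) ∣ cfSeries c - A :=
    (pow_dvd_pow X (Nat.le_succ _)).trans (X_pow_dvd_cfSeries_sub_cfTrunc c (n + 1))
  have hB : X ^ (n + 1) ∣ cfSeries (fun j => c (j + 1)) - B :=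
    X_pow_dvd_cfSeries_sub_cfTrunc _ n
  convert dvd_sub (hA.mul_right (1 - C (c 0) * X * cfSeries fun j => c (j + 1)))
    (hB.mul_left (A * C (c 0) * X)) using 1
  linear_combination hAB

theorem isStieltjesArray_coeff_prod_cfSeries (c : ℕ → K) :
    IsStieltjesArray c fun n h => coeff n
      (cfSeries c * ∏ i ∈ Finset.range h, C (c i) * cfSeries fun j => c (j + (i + 1))) := by
  have tail (i : ℕ) : cfSeries (fun j => c (j + i)) = 1 + C (c i) * X *
      cfSeries (fun j => c (j + i)) * cfSeries fun j => c (j + (i + 1)) := by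
    simpa only [zero_add, add_assoc, add_comm 1 i] using cfSeries_eq_one_add fun j => c (j + i)
  refine isStieltjesArray_coeff ?_ fun h => ?_
  · simp only [Finset.prod_range_zero, Finset.prod_range_one]
    linear_combination tail 0
  · simp only [Finset.prod_range_succ]
    linear_combination (cfSeries c * (∏ i ∈ Finset.range h, C (c i) *
      cfSeries fun j => c (j + (i + 1))) * C (c h)) * tail (h + 1)

theorem coeff_cfSeries {c : ℕ → K} {M : ℕ → ℕ → K} (hM : IsStieltjesArray c M) (n : ℕ) :
    coeff n (cfSeries c) = M n 0 := by
  simpa using (isStieltjesArray_coeff_prod_cfSeries c).unique hM n 0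

end ContinuedFraction

section OrthogonalPolynomials

open Polynomial

variable {R : Type*} [CommRing R]

/-- The monic polynomials with the three-term recurrence `P (n + 2) = X * P (n + 1) - c n * P n`,
that is, the orthogonal polynomials of a symmetric moment functional. -/
noncomputable def orthoPoly (c : ℕ → R) : ℕ → R[X]
  | 0 => 1
  | 1 => X
  | n + 2 => X * orthoPoly c (n + 1) - C (c n) * orthoPoly c n

section MomentFunctional

variable {c : ℕ → R} {L : R[X] →ₗ[R] R}

theorem map_X_pow_succ_mul_orthoPoly_succ (c : ℕ → R) (L : R[X] →ₗ[R] R) (j h : ℕ) :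
    L (X ^ (j + 1) * orthoPoly c (h + 1)) =
      c h * L (X ^ j * orthoPoly c h) + L (X ^ j * orthoPoly c (h + 2)) := by
  rw [← smul_eq_mul (c h), ← map_smul, ← map_add, orthoPoly, smul_eq_C_mul]
  ring_nf

theorem map_X_pow_mul_orthoPoly_eq_zero (hL : ∀ n, L (orthoPoly c (n + 1)) = 0) {j h : ℕ}
    (hjh : j < h) : L (X ^ j * orthoPoly c h) = 0 := by
  induction j generalizing h with
  | zero =>
    obtain ⟨h, rfl⟩ := Nat.exists_eq_add_of_lt hjh
    simpa using hL h
  | succ j ih =>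
    obtain ⟨h, rfl⟩ := Nat.exists_eq_add_of_lt (j.succ_pos.trans hjh)
    rw [zero_add, map_X_pow_succ_mul_orthoPoly_succ, ih (by omega), ih (by omega), mul_zero,
      add_zero]

theorem isStieltjesArray_map_orthoPoly (hL_one : L 1 = 1)
    (hL : ∀ n, L (orthoPoly c (n + 1)) = 0) :
    IsStieltjesArray c fun n h => L (X ^ (h + 2 * n) * orthoPoly c h) where
  zero_zero := by simpa [orthoPoly] using hL_one
  zero_succ h := by
    rw [mul_zero, add_zero, add_zero, map_X_pow_succ_mul_orthoPoly_succ,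
      map_X_pow_mul_orthoPoly_eq_zero hL (by omega : h < h + 2), add_zero]
  succ_zero n := by simp only [orthoPoly]; ring_nf
  succ_succ n h := by
    rw [show h + 1 + 2 * (n + 1) = h + 2 * (n + 1) + 1 by ring, map_X_pow_succ_mul_orthoPoly_succ,
      show h + 2 + 2 * n = h + 2 * (n + 1) by ring]

end MomentFunctional

/-- The symmetric Al-Salam–Chihara polynomials with parameters `±√(-b * q)`, in the monic
normalization in the variable `t + t⁻¹`, after a rescaling of that variable by `√s`. -/
noncomputable def alSalamChihara (q b s : R) : ℕ → R[X] :=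
  orthoPoly fun j => s * ((1 - q ^ (j + 1)) * (1 - b * q ^ (j + 1)))

theorem alSalamChihara_zero (q b s : R) : alSalamChihara q b s 0 = 1 := rfl

theorem alSalamChihara_one (q b s : R) : alSalamChihara q b s 1 = X := rfl

theorem alSalamChihara_add_two (q b s : R) (n : ℕ) :
    alSalamChihara q b s (n + 2) = X * alSalamChihara q b s (n + 1) -
      C (s * ((1 - q ^ (n + 1)) * (1 - b * q ^ (n + 1)))) * alSalamChihara q b s n := rfl

theorem alSalamChihara_add_two_eq_sub (q b : R) (n : ℕ) :
    alSalamChihara q b 1 (n + 2) = X * alSalamChihara q (b * q ^ 2) 1 (n + 1) -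
      C ((1 - q ^ (n + 1)) * (1 - b * q)) * alSalamChihara q (b * q ^ 2) 1 n := by
  induction n using Nat.twoStepInduction with
  | zero => simp [alSalamChihara_add_two, alSalamChihara_one, alSalamChihara_zero]
  | one =>
    simp only [alSalamChihara_add_two, alSalamChihara_one, alSalamChihara_zero, zero_add, map_mul,
      map_sub, map_pow, map_one]
    ring
  | more n ih1 ih2 =>
    rw [alSalamChihara_add_two, ih1, ih2]
    simp only [alSalamChihara_add_two, map_mul, map_sub, map_pow, map_one]
    ring

variable {A : Type*} [CommRing A] [Algebra R A]

theorem aeval_add_smul_alSalamChihara (q b : R) {t t' : A} (ht : t * t' = 1) (n : ℕ) :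
    aeval (t + q • t') (alSalamChihara q (b * q) q (n + 1)) =
      aeval (t + t') (alSalamChihara q (b * q ^ 2) 1 (n + 1)) -
        (1 - q ^ (n + 1)) • t' * aeval (t + t') (alSalamChihara q (b * q ^ 2) 1 n) := by
  simp only [Algebra.smul_def]
  induction n using Nat.twoStepInduction with
  | zero =>
    simp only [zero_add, alSalamChihara_one, alSalamChihara_zero, aeval_X, map_sub, map_pow,
      map_one]
    ring
  | one =>
    simp only [alSalamChihara_add_two, alSalamChihara_one, alSalamChihara_zero, zero_add, aeval_X,
      aeval_C, map_mul, map_sub, map_pow, map_one]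
    linear_combination (2 * algebraMap R A q - 1 - algebraMap R A q ^ 2) * ht
  | more n ih1 ih2 =>
    rw [alSalamChihara_add_two, map_sub, map_mul, map_mul, ih2, ih1]
    simp only [alSalamChihara_add_two, map_mul, map_sub, map_pow, map_one, aeval_X, aeval_C]
    linear_combination ((algebraMap R A q - 1 + algebraMap R A q ^ (n + 2) -
      algebraMap R A q ^ (n + 3)) *
        aeval (t + t') (alSalamChihara q (b * q ^ 2) 1 (n + 1))) * ht

-- The right-hand side is `F (q^(1/2) * t) - F (q^(-1/2) * t)` for a function `F` invariant under
-- `t ↦ t⁻¹`, so this is the action of the Askey–Wilson raising operator.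
theorem sub_mul_aeval_alSalamChihara (q b : R) {t t' : A} (ht : t * t' = 1) (n : ℕ) :
    (t - t') * aeval (t + t') (alSalamChihara q b 1 (n + 1)) =
      t * ((t + (b * q) • t') * aeval (t + q • t') (alSalamChihara q (b * q) q n)) -
        t' * ((t' + (b * q) • t) * aeval (t' + q • t) (alSalamChihara q (b * q) q n)) := by
  cases n with
  | zero =>
    simp only [zero_add, alSalamChihara_one, alSalamChihara_zero, map_one, aeval_X,
      Algebra.smul_def]
    ring
  | succ n =>
    rw [alSalamChihara_add_two_eq_sub, aeval_add_smul_alSalamChihara q b ht,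
      aeval_add_smul_alSalamChihara q b (mul_comm t t' ▸ ht), add_comm t' t]
    simp only [Algebra.smul_def, map_mul, map_sub, map_pow, map_one, aeval_X, aeval_C]
    linear_combination ((1 - algebraMap R A q ^ (n + 1)) *
      (1 - algebraMap R A b * algebraMap R A q) * (t - t') *
      aeval (t + t') (alSalamChihara q (b * q ^ 2) 1 n)) * ht

end OrthogonalPolynomials

section ThetaSum

variable {R : Type*} [CommRing R]

/-- The sum of the first `r` terms of the finite theta sum of order `k`, which has `2 * k + 1`
terms. The truncated subtraction is a genuine one as long as `r ≤ 2 * k + 1`. -/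
def partialTheta (q : R) (k r : ℕ) : R :=
  ∑ i ∈ Finset.range r, (-1) ^ (i + k) * q ^ (i * (2 * k - i) + k)

theorem partialTheta_succ_succ (q : R) {k r : ℕ} (hr : r ≤ 2 * k + 1) :
    partialTheta q (k + 1) (r + 1) =
      q ^ (2 * (k + 1)) * partialTheta q k r + (-q) ^ (k + 1) := by
  have term {i : ℕ} (hi : i < r) :
      (-1 : R) ^ (i + 1 + (k + 1)) * q ^ ((i + 1) * (2 * (k + 1) - (i + 1)) + (k + 1)) =
        q ^ (2 * (k + 1)) * ((-1) ^ (i + k) * q ^ (i * (2 * k - i) + k)) := by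
    obtain ⟨j, hj⟩ := Nat.exists_eq_add_of_le (by omega : i ≤ 2 * k)
    have exponent : (i + 1) * (j + 1) + (k + 1) = 2 * (k + 1) + (i * j + k) := by linarith
    rw [show 2 * (k + 1) - (i + 1) = j + 1 by omega, show 2 * k - i = j by omega, exponent]
    ring
  rw [partialTheta, Finset.sum_range_succ', Finset.sum_congr rfl fun i hi => term
    (Finset.mem_range.1 hi), ← Finset.mul_sum, partialTheta, neg_pow q]
  simp

theorem partialTheta_two_mul_add_one (q : R) (k : ℕ) :
    partialTheta q k (2 * k + 1) = partialTheta q k (k + 1) + partialTheta q k k := by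
  have reflect {i : ℕ} (hi : i < k + 1) :
      (-1 : R) ^ (k + (k - i) + k) * q ^ ((k + (k - i)) * (2 * k - (k + (k - i))) + k) =
        (-1) ^ (i + k) * q ^ (i * (2 * k - i) + k) := by
    obtain ⟨j, rfl⟩ := Nat.exists_eq_add_of_le (Nat.lt_succ_iff.1 hi)
    have sign : (-1 : R) ^ (i + j + j + (i + j)) = (-1) ^ (i + (i + j)) := by
      rw [show i + j + j + (i + j) = i + (i + j) + 2 * j by ring, pow_add,
        (even_two_mul j).neg_one_pow, mul_one]
    rw [Nat.add_sub_cancel_left, show 2 * (i + j) - (i + j + j) = i by omega,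
      show 2 * (i + j) - i = i + j + j by omega, mul_comm (i + j + j), sign]
  rw [partialTheta, show 2 * k + 1 = k + (k + 1) by ring, Finset.sum_range_add,
    ← Finset.sum_range_reflect _ (k + 1), add_comm]
  simp only [Nat.add_sub_cancel]
  rw [Finset.sum_congr rfl fun i hi => reflect (Finset.mem_range.1 hi)]
  rfl

/-- The solution `α` on `ℤ` of the recurrence `α k = q ^ (2 * k) * α (k - 1) + (-q) ^ k` with
`α (-1) = 0`. For negative `k` the recurrence is solved for `α (k - 1)`, so that no negative power
of `q` occurs. -/
def thetaSeq (q : R) : ℤ → R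
  | Int.ofNat k => partialTheta q k (k + 1)
  | Int.negSucc k => -partialTheta q k k

theorem thetaSeq_natCast (q : R) (k : ℕ) : thetaSeq q k = partialTheta q k (k + 1) := rfl

theorem thetaSeq_neg_natCast_sub_one (q : R) (k : ℕ) :
    thetaSeq q (-k - 1) = -partialTheta q k k := by
  rw [show (-k - 1 : ℤ) = Int.negSucc k by omega]
  rfl

theorem thetaSeq_natCast_sub (q : R) (k : ℕ) :
    thetaSeq q k - thetaSeq q (-k - 1) = partialTheta q k (2 * k + 1) := by
  rw [thetaSeq_natCast, thetaSeq_neg_natCast_sub_one, sub_neg_eq_add,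
    partialTheta_two_mul_add_one]

theorem thetaSeq_zero (q : R) : thetaSeq q 0 = 1 := by
  simpa [partialTheta] using thetaSeq_natCast q 0

theorem thetaSeq_neg_one (q : R) : thetaSeq q (-1) = 0 := by
  simpa [partialTheta] using thetaSeq_neg_natCast_sub_one q 0

theorem thetaSeq_natCast_eq (q : R) (k : ℕ) :
    thetaSeq q k = q ^ (2 * k) * thetaSeq q (k - 1) + (-q) ^ k := by
  cases k with
  | zero => simp [thetaSeq_zero, thetaSeq_neg_one]
  | succ k =>
    rw [Nat.cast_succ, add_sub_cancel_right, ← Nat.cast_succ, thetaSeq_natCast, thetaSeq_natCast,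
      partialTheta_succ_succ q (by omega)]

theorem thetaSeq_neg_natCast_sub_one_eq (q : R) (k : ℕ) :
    thetaSeq q (-k - 1) = q ^ (2 * k) * thetaSeq q (-k) - (-q) ^ k := by
  cases k with
  | zero => simp [thetaSeq_zero, thetaSeq_neg_one]
  | succ k =>
    rw [thetaSeq_neg_natCast_sub_one, show (-(k + 1 : ℕ) : ℤ) = -k - 1 by push_cast; ring,
      thetaSeq_neg_natCast_sub_one, partialTheta_succ_succ q (by omega)]
    ring

theorem pow_mul_thetaSeq_sub (q : R) {i j m : ℕ} (h : i + j = 2 * m) :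
    q ^ j * thetaSeq q (i - m) - q ^ i * thetaSeq q (i - m - 1) = (-1) ^ i * (-q) ^ m := by
  rcases le_total m i with hmi | him
  · obtain ⟨k, rfl⟩ := Nat.exists_eq_add_of_le hmi
    obtain rfl : m = j + k := by omega
    have sign : (-1 : R) ^ (j + k + k) * (-1) ^ (j + k) = (-1) ^ k := by
      rw [← pow_add, show j + k + k + (j + k) = k + 2 * (j + k) by ring, pow_add,
        (even_two_mul _).neg_one_pow, mul_one]
    rw [show ((j + k + k : ℕ) - (j + k : ℕ) : ℤ) = k by push_cast; ring, thetaSeq_natCast_eq,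
      neg_pow q, neg_pow q]
    linear_combination (-q ^ (j + k)) * sign
  · obtain ⟨k, rfl⟩ := Nat.exists_eq_add_of_le him
    obtain rfl : j = i + 2 * k := by omega
    have sign : (-1 : R) ^ i * (-1) ^ (i + k) = (-1) ^ k := by
      rw [← pow_add, show i + (i + k) = k + 2 * i by ring, pow_add,
        (even_two_mul _).neg_one_pow, mul_one]
    rw [show (i - (i + k : ℕ) : ℤ) = -k by push_cast; ring, thetaSeq_neg_natCast_sub_one_eq,
      neg_pow q, neg_pow q]
    linear_combination (-q ^ (i + k)) * sign

end ThetaSum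

section ThetaFunctional

open LaurentPolynomial

variable {R : Type*} [CommRing R]

/-- The linear functional on Laurent polynomials that maps `T (2 * k + 1)` to `thetaSeq q k` and the
even powers of `T` to `0`. -/
noncomputable def thetaFunctional (q : R) : R[T;T⁻¹] →ₗ[R] R :=
  Finsupp.linearCombination R (Function.extend (fun k : ℤ => 2 * k + 1) (thetaSeq q) 0) ∘ₗ
    (AddMonoidAlgebra.coeffLinearEquiv R).toLinearMap

theorem thetaFunctional_T (q : R) (j : ℤ) :
    thetaFunctional q (T j) = Function.extend (fun k : ℤ => 2 * k + 1) (thetaSeq q) 0 j := by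
  change Finsupp.linearCombination R _ (Finsupp.single j 1) = _
  simp

theorem thetaFunctional_T_odd (q : R) (k : ℤ) :
    thetaFunctional q (T (2 * k + 1)) = thetaSeq q k := by
  have injective : Function.Injective fun k : ℤ => 2 * k + 1 := fun k l h => by
    simpa using h
  rw [thetaFunctional_T, injective.extend_apply]

theorem thetaFunctional_T_even (q : R) (k : ℤ) : thetaFunctional q (T (2 * k)) = 0 := by
  rw [thetaFunctional_T, Function.extend_apply' _ _ _ (by rintro ⟨l, hl⟩; omega), Pi.zero_apply]

theorem T_mul_add_pow (x y : R) (e : ℤ) (n : ℕ) :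
    (T e * (x • T 1 + y • T (-1)) ^ n : R[T;T⁻¹]) =
      ∑ i ∈ Finset.range (n + 1), (x ^ i * y ^ (n - i) * n.choose i) • T (e + 2 * i - n) := by
  rw [add_pow, Finset.mul_sum]
  refine Finset.sum_congr rfl fun i hi => ?_
  have hin : i ≤ n := Nat.lt_succ_iff.1 (Finset.mem_range.1 hi)
  have exponent : e + 2 * i - n = e + (i * 1 + (n - i : ℕ) * (-1)) := by
    push_cast [hin]; ring
  rw [exponent, T_add, T_add, ← T_pow, ← T_pow, smul_pow, smul_pow]
  simp only [smul_eq_C_mul, map_mul, map_natCast]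
  ring

theorem thetaFunctional_T_one_mul_add_pow (q : R) {n : ℕ} (hn : n ≠ 0) :
    thetaFunctional q (T 1 * (T 1 + q • T (-1)) ^ n) =
      thetaFunctional q (T (-1) * (T (-1) + q • T 1) ^ n) := by
  have left := T_mul_add_pow 1 q 1 n
  have right := T_mul_add_pow q 1 (-1) n
  rw [one_smul] at left
  rw [one_smul, add_comm (q • _)] at right
  rw [left, right, ← sub_eq_zero, map_sum, map_sum, ← Finset.sum_sub_distrib]
  simp only [map_smul, smul_eq_mul, one_pow, one_mul, mul_one]
  obtain ⟨m, rfl | rfl⟩ := n.even_or_odd'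
  · have term {i : ℕ} (hi : i ≤ 2 * m) :
        q ^ (2 * m - i) * (2 * m).choose i * thetaFunctional q (T (1 + 2 * i - (2 * m : ℕ))) -
          q ^ i * (2 * m).choose i * thetaFunctional q (T (-1 + 2 * i - (2 * m : ℕ))) =
            (-q) ^ m * ((-1) ^ i * (2 * m).choose i) := by
      rw [show (1 + 2 * i - (2 * m : ℕ) : ℤ) = 2 * (i - m) + 1 by push_cast; ring,
        show (-1 + 2 * i - (2 * m : ℕ) : ℤ) = 2 * (i - m - 1) + 1 by push_cast; ring,
        thetaFunctional_T_odd, thetaFunctional_T_odd]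
      linear_combination ((2 * m).choose i : R) *
        pow_mul_thetaSeq_sub q (Nat.add_sub_of_le hi)
    rw [Finset.sum_congr rfl fun i hi => term (Nat.lt_succ_iff.1 (Finset.mem_range.1 hi)),
      ← Finset.mul_sum]
    have alternating := congrArg (Int.cast : ℤ → R) (Int.alternating_sum_range_choose_of_ne hn)
    push_cast at alternating
    rw [alternating, mul_zero]
  · refine Finset.sum_eq_zero fun i _ => ?_
    rw [show (1 + 2 * i - (2 * m + 1 : ℕ) : ℤ) = 2 * (i - m) by push_cast; ring,
      show (-1 + 2 * i - (2 * m + 1 : ℕ) : ℤ) = 2 * (i - m - 1) by push_cast; ring,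
      thetaFunctional_T_even, thetaFunctional_T_even, mul_zero, mul_zero, sub_zero]

theorem thetaFunctional_T_one_mul_aeval (q : R) (f : Polynomial R) :
    thetaFunctional q (T 1 * Polynomial.aeval (T 1 + q • T (-1)) (Polynomial.X * f)) =
      thetaFunctional q (T (-1) * Polynomial.aeval (T (-1) + q • T 1) (Polynomial.X * f)) := by
  induction f using Polynomial.induction_on' with
  | add f g hf hg => simp only [mul_add, map_add, hf, hg]
  | monomial n a =>
    rw [← Polynomial.C_mul_X_pow_eq_monomial, ← Polynomial.smul_eq_C_mul, mul_smul_comm,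
      ← pow_succ']
    simp only [map_smul, map_pow, Polynomial.aeval_X, mul_smul_comm]
    rw [thetaFunctional_T_one_mul_add_pow q n.succ_ne_zero]

end ThetaFunctional

theorem binom_natCast (n k : ℕ) : binom n k = n.choose k := by
  rw [binom, if_pos k.cast_nonneg, Int.toNat_natCast]

theorem binom_neg_one (n : ℕ) : binom n (-1) = 0 := rfl

theorem mul_add_pow_two_mul_eq_sum_binom {A : Type*} [CommRing A] {t t' : A}
    (ht : t * t' = 1) (n : ℕ) :
    t * (t + t') ^ (2 * n) = ∑ k ∈ Finset.range (n + 1),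
      ((binom (2 * n) (n - k) : A) * t ^ (2 * k + 1) +
        (binom (2 * n) (n - k - 1) : A) * t' ^ (2 * k + 1)) := by
  have upper {k : ℕ} (hk : k < n + 1) :
      t * (t ^ (n + k) * t' ^ (2 * n - (n + k)) * (2 * n).choose (n + k)) =
        binom (2 * n) (n - k) * t ^ (2 * k + 1) := by
    obtain ⟨j, rfl⟩ := Nat.exists_eq_add_of_le (Nat.lt_succ_iff.1 hk)
    have unit : t ^ j * t' ^ j = 1 := by rw [← mul_pow, ht, one_pow]
    rw [show ((k + j : ℕ) - k : ℤ) = j by push_cast; ring, binom_natCast,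
      show 2 * (k + j) - (k + j + k) = j by omega,
      Nat.choose_symm_of_eq_add (show 2 * (k + j) = (k + j + k) + j by ring)]
    linear_combination (t ^ (2 * k + 1) * (2 * (k + j)).choose j) * unit
  have lower {k : ℕ} (hk : k < n) :
      t * (t ^ (n - 1 - k) * t' ^ (2 * n - (n - 1 - k)) * (2 * n).choose (n - 1 - k)) =
        binom (2 * n) (n - k - 1) * t' ^ (2 * k + 1) := by
    obtain ⟨j, rfl⟩ := Nat.exists_eq_add_of_lt hk
    have unit : t ^ (j + 1) * t' ^ (j + 1) = 1 := by rw [← mul_pow, ht, one_pow]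
    rw [show ((k + j + 1 : ℕ) - k - 1 : ℤ) = j by push_cast; ring, binom_natCast,
      show k + j + 1 - 1 - k = j by omega,
      show 2 * (k + j + 1) - j = (j + 1) + (2 * k + 1) by omega]
    linear_combination (t' ^ (2 * k + 1) * (2 * (k + j + 1)).choose j) * unit
  rw [add_pow, Finset.mul_sum, show 2 * n + 1 = n + (n + 1) by ring, Finset.sum_range_add,
    ← Finset.sum_range_reflect, Finset.sum_add_distrib, add_comm,
    Finset.sum_range_succ (fun k => (binom (2 * n) (n - k - 1) : A) * t' ^ (2 * k + 1)),
    sub_self, zero_sub, binom_neg_one, Nat.cast_zero, zero_mul, add_zero,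
    Finset.sum_congr rfl fun k hk => upper (Finset.mem_range.1 hk),
    Finset.sum_congr rfl fun k hk => lower (Finset.mem_range.1 hk)]

theorem sub_mul_add_pow_two_mul_eq_sum_binom {A : Type*} [CommRing A] {t t' : A}
    (ht : t * t' = 1) (n : ℕ) :
    (t - t') * (t + t') ^ (2 * n) = ∑ k ∈ Finset.range (n + 1),
      ((binom (2 * n) (n - k) : A) - binom (2 * n) (n - k - 1)) *
        (t ^ (2 * k + 1) - t' ^ (2 * k + 1)) := by
  rw [sub_mul, mul_add_pow_two_mul_eq_sum_binom ht, add_comm t t',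
    mul_add_pow_two_mul_eq_sum_binom (mul_comm t t' ▸ ht), ← Finset.sum_sub_distrib]
  exact Finset.sum_congr rfl fun k _ => by ring

section SecantFunctional

open LaurentPolynomial

variable {R : Type*} [CommRing R]

theorem T_one_mul_T_neg_one : (T 1 * T (-1) : R[T;T⁻¹]) = 1 := by
  rw [← T_add, add_neg_cancel, T_zero]

/-- The moment functional of the polynomials `alSalamChihara q 1 1`, whose recurrence coefficients
are `(1 - q ^ n) ^ 2`. -/
noncomputable def secantFunctional (q : R) : Polynomial R →ₗ[R] R :=
  thetaFunctional q ∘ₗ LinearMap.mulLeft R (T 1 - T (-1)) ∘ₗ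
    (Polynomial.aeval (T 1 + T (-1))).toLinearMap

theorem secantFunctional_apply (q : R) (f : Polynomial R) :
    secantFunctional q f =
      thetaFunctional q ((T 1 - T (-1)) * Polynomial.aeval (T 1 + T (-1)) f) := rfl

theorem secantFunctional_X_pow_two_mul (q : R) (n : ℕ) :
    secantFunctional q (Polynomial.X ^ (2 * n)) = ∑ k ∈ Finset.range (n + 1),
      ((binom (2 * n) (n - k) : R) - binom (2 * n) (n - k - 1)) *
        partialTheta q k (2 * k + 1) := by
  rw [secantFunctional_apply, map_pow, Polynomial.aeval_X,
    sub_mul_add_pow_two_mul_eq_sum_binom T_one_mul_T_neg_one, map_sum]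
  refine Finset.sum_congr rfl fun k _ => ?_
  set a := binom (2 * n) (n - k)
  set b := binom (2 * n) (n - k - 1)
  have scalar (f : R[T;T⁻¹]) : ((a : R[T;T⁻¹]) - b) * f = ((a : R) - b) • f := by
    rw [smul_eq_C_mul, map_sub, map_natCast, map_natCast]
  rw [scalar, map_smul, smul_eq_mul, map_sub, T_pow, T_pow,
    show ((2 * k + 1 : ℕ) * 1 : ℤ) = 2 * k + 1 by push_cast; ring,
    show ((2 * k + 1 : ℕ) * (-1) : ℤ) = 2 * (-k - 1) + 1 by push_cast; ring,
    thetaFunctional_T_odd, thetaFunctional_T_odd, thetaSeq_natCast_sub]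

theorem secantFunctional_one (q : R) : secantFunctional q 1 = 1 := by
  simpa [binom, partialTheta] using secantFunctional_X_pow_two_mul q 0

theorem secantFunctional_alSalamChihara_succ (q : R) (n : ℕ) :
    secantFunctional q (alSalamChihara q 1 1 (n + 1)) = 0 := by
  have raising := sub_mul_aeval_alSalamChihara q 1 (T_one_mul_T_neg_one (R := R)) n
  have adjoint := thetaFunctional_T_one_mul_aeval q (alSalamChihara q q q n)
  simp only [map_mul, Polynomial.aeval_X] at adjoint
  rw [secantFunctional_apply, raising, one_mul, map_sub, adjoint, sub_self]

theorem isStieltjesArray_secantFunctional (q : R) :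
    IsStieltjesArray (fun j => (1 - q ^ (j + 1)) ^ 2) fun n h =>
      secantFunctional q (Polynomial.X ^ (h + 2 * n) * alSalamChihara q 1 1 h) := by
  have coeff_eq : (fun j => (1 - q ^ (j + 1)) ^ 2) =
      fun j => 1 * ((1 - q ^ (j + 1)) * (1 - 1 * q ^ (j + 1))) := by
    funext j; ring
  rw [coeff_eq]
  exact isStieltjesArray_map_orthoPoly (secantFunctional_one q)
    (secantFunctional_alSalamChihara_succ q)

end SecantFunctional

theorem theorem4 {K : Type*} [Field K] (q : K) (hq : q ≠ 1) (n : ℕ) :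
    qSecant q n =
      1 / (1 - q) ^ (2 * n) *
        ∑ k ∈ Finset.range (n + 1),
          ((binom (2 * n) ((n : ℤ) - k) : K) - (binom (2 * n) ((n : ℤ) - k - 1) : K)) *
            ∑ i ∈ Finset.range (2 * k + 1), (-1) ^ (i + k) * q ^ (i * (2 * k - i) + k) := by
  have coeff_eq : (fun j => qInt q (j + 1) ^ 2) =
      fun j => ((1 - q) ^ 2)⁻¹ * (1 - q ^ (j + 1)) ^ 2 := by
    funext j
    rw [qInt, div_pow, div_eq_inv_mul]
  have array := (isStieltjesArray_secantFunctional q).smul ((1 - q) ^ 2)⁻¹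
  rw [qSecant, coeff_eq, coeff_cfSeries array, alSalamChihara_zero, mul_one, add_zero, zero_add,
    inv_pow, ← pow_mul, ← one_div, secantFunctional_X_pow_two_mul]
  rfl
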